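/- Let $N\ge 2$ and let $\Phi=\{\varphi_i\}_{i=1}^M$ be a unit-norm frame for $\mathbb R^N$, that is, $\|\varphi_i\|_2=1$ for all $i$ and there are constants $0<A\le B$ with $A\|x\|^2\le\sum_{i=1}^M|\langle x,\varphi_i\rangle|^2\le B\|x\|^2$ for all $x\in\mathbb R^N$. Let $$D_\Phi=\min_{c_1,\dots,c_M\ge 0}\Big\|\sum_{i=1}^M c_i\varphi_i\varphi_i^T-I\Big\|_F$$ be the Frobenius-norm distance of the identity matrix to the cone generated by the matrices $\varphi_i\varphi_i^T$, and let $V_\Phi=\operatorname{Vol}(E_\Phi)/\omega_N$, where $E_\Phi$ is the ellipsoid of minimal volume containing the convex hull of $\{\pm\varphi_i\}_{i=1}^M$ and $\omega_N$ is the volume of the unit ball of $\mathbb R^N$. Then $$\frac{N(1-D_\Phi^2)}{N-D_\Phi^2}\;\le\; V_\Phi^{4/N}\;\le\;\frac{N(N-1-D_\Phi^2)}{(N-1)(N-D_\Phi^2)}\;\le\;1,$$ where the leftmost inequality is asserted under the condition $D_\Phi<1$. Consequently, for fixed $N$, $V_\Phi\to1$ is equivalent to $D_\Phi\to0$: if $(\Phi_k)_k$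 is any sequence (or any family indexed by a set with a filter) of unit-norm frames for $\mathbb R^N$, with possibly varying numbers of vectors, then $V_{\Phi_k}\to1$ if and only if $D_{\Phi_k}\to0$. -/

import Mathlib

open scoped Matrix Topology
open MeasureTheory Filter

noncomputable section

namespace UnitFrame

/-- The Euclidean space `ℝ^N`. -/
abbrev E (N : ℕ) : Type := EuclideanSpace ℝ (Fin N)

/-- A finite sequence of vectors is a frame for `ℝ^N` if it has frame bounds `0 < A ≤ B`. -/
def IsFrame {M N : ℕ} (Φ : Fin M → E N) : Prop :=
  ∃ A B : ℝ, 0 < A ∧ A ≤ B ∧ ∀ x : E N,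
    A * ‖x‖ ^ 2 ≤ ∑ i, |inner ℝ x (Φ i)| ^ 2 ∧
      ∑ i, |inner ℝ x (Φ i)| ^ 2 ≤ B * ‖x‖ ^ 2

/-- The class of unit norm frames of `M` vectors in `ℝ^N`. -/
def IsUnitNormFrame {M N : ℕ} (Φ : Fin M → E N) : Prop :=
  IsFrame Φ ∧ ∀ i, ‖Φ i‖ = 1

section Frobenius

attribute [local instance] Matrix.frobeniusNormedAddCommGroup

/-- The distance, in the Frobenius norm, of the identity matrix to the cone
`{∑ i, c i • φ i (φ i)ᵀ : c ≥ 0}`. This (closed) cone contains `0`, so the infimum is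
taken over a nonempty set of nonnegative numbers. -/
def coneDist {M N : ℕ} (Φ : Fin M → E N) : ℝ :=
  ⨅ c : {c : Fin M → ℝ // ∀ i, 0 ≤ c i},
    ‖(∑ i, c.1 i • Matrix.vecMulVec (Φ i).ofLp (Φ i).ofLp) - (1 : Matrix (Fin N) (Fin N) ℝ)‖

end Frobenius

/-- The set `{v : ⟨X (v - c), v - c⟩ ≤ 1}`. -/
def ellipsoid {N : ℕ} (X : Matrix (Fin N) (Fin N) ℝ) (c : E N) : Set (E N) :=
  {v | (X *ᵥ (v - c).ofLp) ⬝ᵥ (v - c).ofLp ≤ 1}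

/-- Ellipsoids in `ℝ^N`, with arbitrary centre. -/
def IsEllipsoid {N : ℕ} (S : Set (E N)) : Prop :=
  ∃ (X : Matrix (Fin N) (Fin N) ℝ) (c : E N), X.PosDef ∧ S = ellipsoid X c

/-- `S` is an ellipsoid of minimal volume among all ellipsoids containing `K`. -/
def IsMinimalEllipsoid {N : ℕ} (K S : Set (E N)) : Prop :=
  IsEllipsoid S ∧ K ⊆ S ∧ ∀ T : Set (E N), IsEllipsoid T → K ⊆ T → volume S ≤ volume T

/-- The symmetrized sequence `{φ i} ∪ {-φ i}`. -/
def symmetrization {M N : ℕ} (Φ : Fin M → E N) : Set (E N) :=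
  Set.range Φ ∪ Set.range (fun i => -Φ i)

/-- The minimal (Löwner) ellipsoid of `Φ`: the ellipsoid of minimal volume that contains the
convex hull of the symmetrization of `Φ`. (It exists and is unique when `Φ` is a frame.) -/
def minimalEllipsoid {M N : ℕ} (Φ : Fin M → E N) : Set (E N) :=
  Classical.epsilon (IsMinimalEllipsoid (convexHull ℝ (symmetrization Φ)))

/-- The volume of the minimal ellipsoid of `Φ`, divided by the volume of the unit ball. -/
def normalizedVolume {M N : ℕ} (Φ : Fin M → E N) : ℝ :=
  (volume (minimalEllipsoid Φ)).toReal / (volume (Metric.closedBall (0 : E N) 1)).toReal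

end UnitFrame

end

/-!
Let `c ≥ 0` have total mass `N` and maximize the determinant of `S = ∑ i, c i • φ i (φ i)ᵀ`. By the
first-order optimality conditions (Kiefer–Wolfowitz) the ellipsoid `⟨S⁻¹ v, v⟩ ≤ 1` contains all
`±φ i`. It is the Löwner ellipsoid: if an ellipsoid of matrix `X` contains all `±φ i`, then
`tr (X S) ≤ N`, and AM–GM for the eigenvalues gives `det X * det S ≤ 1`. Hence `V ^ 2 = det S`,
while `tr S = N` because the frame vectors are unit vectors.

Write `W = V ^ (4 / N) = (det S) ^ (2 / N)`. For the upper bound on `W`, Maclaurin's inequality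
between the second and the last elementary symmetric means of the eigenvalues bounds `W` in terms of
`tr S²`, and the distance from the identity to the ray `ℝ₊ S` relates `tr S²` to `D`. For the lower
bound, Kober's inequality applied to an arbitrary point `T` of the cone bounds `tr T²` from below in
terms of `tr T` and `det T`, and `det T ≤ (tr T / N) ^ N * det S` by optimality of `S`; minimizing
`tr T² - 2 tr T + N = ‖T - 1‖²` over `tr T` bounds `D` from below in terms of `W`.
-/

namespace UnitFrame

section Inequalities

variable {ι : Type*} {s : Finset ι} {x : ι → ℝ}

lemma card_mul_sq_geom_mean_sub_le_sum_sq_sub {t : ℝ} (ht : 0 < t) (hx : ∀ i ∈ s, t ≤ x i) :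
    s.card * ((∏ i ∈ s, x i) ^ (s.card : ℝ)⁻¹ - t) ^ 2 ≤ ∑ i ∈ s, (x i - t) ^ 2 := by
  rcases s.eq_empty_or_nonempty with rfl | hs
  · simp
  have hcard : (0 : ℝ) < s.card := by exact_mod_cast hs.card_pos
  have hpos : ∀ i ∈ s, 0 < x i := fun i hi => ht.trans_le (hx i hi)
  have hconv : ConvexOn ℝ (Set.Ici (Real.log t)) fun u => (Real.exp u - t) ^ 2 := by
    refine ConvexOn.pow (f := fun u => Real.exp u - t) ?_ (fun u hu => ?_) 2
    · exact (convexOn_exp.subset (Set.subset_univ _) (convex_Ici _)).sub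
        (concaveOn_const t (convex_Ici _))
    · exact sub_nonneg.mpr ((Real.log_le_iff_le_exp ht).mp hu)
  have jensen := hconv.map_sum_le (t := s) (w := fun _ => (s.card : ℝ)⁻¹)
    (p := fun i => Real.log (x i)) (fun _ _ => by positivity)
    (by simp [hcard.ne']) (fun i hi => Real.log_le_log ht (hx i hi))
  have exp_mean_log : Real.exp (∑ i ∈ s, (s.card : ℝ)⁻¹ • Real.log (x i))
      = (∏ i ∈ s, x i) ^ (s.card : ℝ)⁻¹ := by
    rw [Real.rpow_def_of_pos (Finset.prod_pos hpos), Real.log_prod fun i hi => (hpos i hi).ne',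
      ← Finset.smul_sum, smul_eq_mul, mul_comm]
  have mean_exp_log : ∑ i ∈ s, (s.card : ℝ)⁻¹ • (Real.exp (Real.log (x i)) - t) ^ 2
      = (s.card : ℝ)⁻¹ * ∑ i ∈ s, (x i - t) ^ 2 := by
    rw [← Finset.smul_sum, smul_eq_mul]
    exact congrArg _ (Finset.sum_congr rfl fun i hi => by rw [Real.exp_log (hpos i hi)])
  rw [exp_mean_log, mean_exp_log] at jensen
  exact (le_inv_mul_iff₀ hcard).mp jensen

lemma two_mul_mul_mul_le_succ_mul_rpow_add {m : ℕ} (hm : m ≠ 0) {g t : ℝ} (hg : 0 ≤ g)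
    (ht : 0 ≤ t) :
    2 * m * (g * t) ≤ (m + 1) * (t * g ^ m) ^ (2 / (m + 1 : ℝ)) + (m - 1) * t ^ 2 := by
  have hm1 : (0 : ℝ) ≤ m - 1 := sub_nonneg.mpr (by exact_mod_cast Nat.one_le_iff_ne_zero.mpr hm)
  have : (0 : ℝ) < m := by linarith
  have amgm := Real.geom_mean_le_arith_mean2_weighted (w₁ := (m + 1) / (2 * m))
    (w₂ := (m - 1) / (2 * m)) (p₁ := (t * g ^ m) ^ (2 / (m + 1 : ℝ))) (p₂ := t ^ 2)
    (by positivity) (by positivity) (by positivity) (by positivity) (by field_simp; ring)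
  have geom_mean_eq : ((t * g ^ m) ^ (2 / (m + 1 : ℝ))) ^ ((m + 1 : ℝ) / (2 * m))
      * (t ^ 2) ^ ((m - 1 : ℝ) / (2 * m)) = g * t := by
    have factor_left : ((t * g ^ m) ^ (2 / (m + 1 : ℝ))) ^ ((m + 1 : ℝ) / (2 * m))
        = t ^ (m : ℝ)⁻¹ * g := by
      rw [← Real.rpow_mul (by positivity),
        show 2 / (m + 1 : ℝ) * ((m + 1) / (2 * m)) = (m : ℝ)⁻¹ by field_simp,
        Real.mul_rpow ht (by positivity), Real.pow_rpow_inv_natCast hg hm]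
    have factor_right : (t ^ 2) ^ ((m - 1 : ℝ) / (2 * m)) = t ^ ((m - 1 : ℝ) / m) := by
      rw [← Real.rpow_natCast t 2, ← Real.rpow_mul ht]
      congr 1
      push_cast
      field_simp
    rw [factor_left, factor_right, mul_right_comm,
      ← Real.rpow_add_of_nonneg ht (by positivity) (by positivity),
      show (m : ℝ)⁻¹ + (m - 1) / m = 1 by field_simp; ring, Real.rpow_one, mul_comm]
  calc 2 * m * (g * t)
      ≤ 2 * m * ((m + 1) / (2 * m) * (t * g ^ m) ^ (2 / (m + 1 : ℝ))
        + (m - 1) / (2 * m) * t ^ 2) := by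
        gcongr
        exact geom_mean_eq.symm.trans_le amgm
    _ = (m + 1) * (t * g ^ m) ^ (2 / (m + 1 : ℝ)) + (m - 1) * t ^ 2 := by field_simp

lemma pow_rpow_two_div {m : ℕ} (hm : m ≠ 0) {a : ℝ} (ha : 0 ≤ a) :
    (a ^ m) ^ (2 / (m : ℝ)) = a ^ 2 := by
  rw [← Real.rpow_natCast, ← Real.rpow_mul ha, mul_div_cancel₀ _ (by exact_mod_cast hm),
    Real.rpow_ofNat]

-- Induction on `s`, removing the smallest entry `t`: by Jensen's inequality for `(exp u - t) ^ 2`,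
-- the other entries may be replaced by their geometric mean.
theorem kober_inequality (hx : ∀ i ∈ s, 0 ≤ x i) :
    (∑ i ∈ s, x i) ^ 2
      ≤ (s.card - 1) * ∑ i ∈ s, x i ^ 2 + s.card * (∏ i ∈ s, x i) ^ (2 / (s.card : ℝ)) := by
  classical
  induction s using Finset.induction_on_min_value x with
  | empty => simp
  | insert a s ha hmin ih =>
    obtain ⟨hxa, hxs⟩ := (Finset.forall_mem_insert a s _).mp hx
    rcases s.eq_empty_or_nonempty with rfl | hs
    · simp
    have hcard : s.card ≠ 0 := hs.card_ne_zero
    rw [Finset.sum_insert ha, Finset.sum_insert ha, Finset.prod_insert ha,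
      Finset.card_insert_of_notMem ha]
    push_cast
    rcases hxa.eq_or_lt with h0 | hpos
    · have cauchy_schwarz := sq_sum_le_card_mul_sum_sq (s := s) (f := x)
      rw [← h0, zero_mul, Real.zero_rpow (by positivity)]
      simpa using cauchy_schwarz
    set g := (∏ i ∈ s, x i) ^ (s.card : ℝ)⁻¹
    have hg0 : 0 ≤ g := Real.rpow_nonneg (Finset.prod_nonneg hxs) _
    have hg_pow : g ^ s.card = ∏ i ∈ s, x i :=
      Real.rpow_inv_natCast_pow (Finset.prod_nonneg hxs) hcard
    have hg_sq : (∏ i ∈ s, x i) ^ (2 / (s.card : ℝ)) = g ^ 2 := by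
      rw [← hg_pow, pow_rpow_two_div hcard hg0]
    have sum_sq_sub : ∑ i ∈ s, (x i - x a) ^ 2
        = ∑ i ∈ s, x i ^ 2 - 2 * x a * ∑ i ∈ s, x i + s.card * x a ^ 2 := by
      simp only [sub_sq, Finset.sum_add_distrib, Finset.sum_sub_distrib, Finset.mul_sum,
        Finset.sum_const, nsmul_eq_mul, mul_right_comm]
    have hjensen := card_mul_sq_geom_mean_sub_le_sum_sq_sub hpos hmin
    have hamgm := two_mul_mul_mul_le_succ_mul_rpow_add hcard hg0 hxa
    have hind := ih hxs
    rw [sum_sq_sub] at hjensen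
    rw [hg_pow] at hamgm
    rw [hg_sq] at hind
    linear_combination hind + hjensen + hamgm

lemma sum_offDiag_mul {R : Type*} [CommRing R] (s : Finset ι) (x : ι → R) :
    ∑ p ∈ s.offDiag, x p.1 * x p.2 = (∑ i ∈ s, x i) ^ 2 - ∑ i ∈ s, x i ^ 2 := by
  classical
  have hdiag : ∑ p ∈ s.diag, x p.1 * x p.2 = ∑ i ∈ s, x i ^ 2 := by
    simp only [Finset.sum_diag, sq]
  rw [eq_sub_iff_add_eq', ← hdiag, ← Finset.sum_union (Finset.disjoint_diag_offDiag s),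
    Finset.diag_union_offDiag, sq, Finset.sum_mul_sum, Finset.sum_product]

lemma prod_offDiag_mul {R : Type*} [CommMonoid R] (s : Finset ι) (x : ι → R) :
    ∏ p ∈ s.offDiag, x p.1 * x p.2 = (∏ i ∈ s, x i) ^ (2 * (s.card - 1)) := by
  classical
  have prod_pow_card_erase : ∏ i ∈ s, ∏ _j ∈ s.erase i, x i = (∏ i ∈ s, x i) ^ (s.card - 1) := by
    rw [← Finset.prod_pow]
    exact Finset.prod_congr rfl fun i hi => by rw [Finset.prod_const, Finset.card_erase_of_mem hi]
  rw [Finset.prod_mul_distrib, two_mul, pow_add, ← prod_pow_card_erase]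
  congr 1
  · exact Finset.prod_finset_product _ s s.erase (by grind)
  · exact Finset.prod_finset_product_right _ s s.erase (by grind)

theorem maclaurin_inequality_two (hx : ∀ i ∈ s, 0 ≤ x i) :
    s.card * (s.card - 1) * (∏ i ∈ s, x i) ^ (2 / (s.card : ℝ))
      ≤ (∑ i ∈ s, x i) ^ 2 - ∑ i ∈ s, x i ^ 2 := by
  classical
  rcases lt_or_ge s.card 2 with hlt | hcard
  · obtain h | h : s.card = 0 ∨ s.card = 1 := by omega
    · simp [Finset.card_eq_zero.mp h]
    · obtain ⟨a, rfl⟩ := Finset.card_eq_one.mp h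
      simp
  have hcard_sub : ((s.card - 1 : ℕ) : ℝ) = s.card - 1 := by
    rw [Nat.cast_sub (by omega), Nat.cast_one]
  have hcard_sub_pos : (0 : ℝ) < s.card - 1 := by
    rw [← hcard_sub, Nat.cast_pos]
    omega
  have hsum_one : ∑ _p ∈ s.offDiag, (1 : ℝ) = s.card * (s.card - 1) := by
    rw [Finset.sum_const, Finset.offDiag_card, nsmul_one, Nat.cast_sub (Nat.le_mul_self _)]
    push_cast
    ring
  have hexponent : ((2 * (s.card - 1) : ℕ) : ℝ) * ((s.card : ℝ) * (s.card - 1))⁻¹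
      = 2 / s.card := by
    rw [Nat.cast_mul, hcard_sub, Nat.cast_ofNat]
    field_simp
  have amgm := Real.geom_mean_le_arith_mean s.offDiag (fun _ => 1) (fun p => x p.1 * x p.2)
    (fun _ _ => zero_le_one) (by rw [hsum_one]; positivity) fun p hp =>
      have hp := Finset.mem_offDiag.mp hp
      mul_nonneg (hx _ hp.1) (hx _ hp.2.1)
  simp only [Real.rpow_one, one_mul] at amgm
  rwa [hsum_one, sum_offDiag_mul, prod_offDiag_mul, ← Real.rpow_natCast,
    ← Real.rpow_mul (Finset.prod_nonneg hx), hexponent, le_div_iff₀' (by positivity)] at amgm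

end Inequalities

section Matrix

open Matrix
open scoped MatrixOrder

variable {n : Type*} [Fintype n]

lemma exists_eq_transpose_mul_self {A : Matrix n n ℝ} (hA : A.PosSemidef) :
    ∃ B : Matrix n n ℝ, A = Bᵀ * B := by
  classical
  obtain ⟨B, hB⟩ := CStarAlgebra.nonneg_iff_eq_star_mul_self.mp hA.nonneg
  exact ⟨B, by rwa [star_eq_conjTranspose, conjTranspose_eq_transpose_of_trivial] at hB⟩

lemma trace_mul_nonneg {A B : Matrix n n ℝ} (hA : A.PosSemidef) (hB : B.PosSemidef) :
    0 ≤ (A * B).trace := by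
  obtain ⟨C, rfl⟩ := exists_eq_transpose_mul_self hA
  rw [← trace_mul_cycle, ← conjTranspose_eq_transpose_of_trivial C]
  exact (hB.mul_mul_conjTranspose_same C).trace_nonneg

variable [DecidableEq n]

lemma trace_pow_eq_sum_eigenvalues_pow {𝕜 : Type*} [RCLike 𝕜] {A : Matrix n n 𝕜}
    (hA : A.IsHermitian) (k : ℕ) : (A ^ k).trace = ∑ i, (hA.eigenvalues i : 𝕜) ^ k := by
  conv_lhs => rw [hA.spectral_theorem, ← map_pow, diagonal_pow]
  rw [Unitary.conjStarAlgAut_apply, trace_mul_cycle, Unitary.coe_star_mul_self, one_mul,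
    trace_diagonal]
  rfl

lemma trace_sq_le_of_posSemidef {A : Matrix n n ℝ} (hA : A.PosSemidef) :
    A.trace ^ 2 ≤ (Fintype.card n - 1) * (A ^ 2).trace
      + Fintype.card n * A.det ^ (2 / (Fintype.card n : ℝ)) := by
  rw [hA.1.det_eq_prod_eigenvalues, hA.1.trace_eq_sum_eigenvalues,
    trace_pow_eq_sum_eigenvalues_pow hA.1]
  exact kober_inequality (s := .univ) fun i _ => hA.eigenvalues_nonneg i

lemma card_mul_det_rpow_le_of_posSemidef {A : Matrix n n ℝ} (hA : A.PosSemidef) :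
    Fintype.card n * (Fintype.card n - 1) * A.det ^ (2 / (Fintype.card n : ℝ))
      ≤ A.trace ^ 2 - (A ^ 2).trace := by
  rw [hA.1.det_eq_prod_eigenvalues, hA.1.trace_eq_sum_eigenvalues,
    trace_pow_eq_sum_eigenvalues_pow hA.1]
  exact maclaurin_inequality_two (s := .univ) fun i _ => hA.eigenvalues_nonneg i

lemma det_le_trace_div_card_pow {A : Matrix n n ℝ} (hA : A.PosSemidef) :
    A.det ≤ (A.trace / Fintype.card n) ^ Fintype.card n := by
  rcases isEmpty_or_nonempty n with _ | _
  · simp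
  have hprod : 0 ≤ ∏ i, hA.1.eigenvalues i := Finset.prod_nonneg fun i _ => hA.eigenvalues_nonneg i
  have amgm := Real.geom_mean_le_arith_mean Finset.univ (fun _ => 1) hA.1.eigenvalues
    (fun _ _ => zero_le_one) (by simp [Fintype.card_pos]) (fun i _ => hA.eigenvalues_nonneg i)
  simp only [Real.rpow_one, Finset.sum_const, Finset.card_univ, nsmul_eq_mul, mul_one,
    one_mul] at amgm
  rw [hA.1.det_eq_prod_eigenvalues, hA.1.trace_eq_sum_eigenvalues]
  calc ∏ i, hA.1.eigenvalues i
      = ((∏ i, hA.1.eigenvalues i) ^ (Fintype.card n : ℝ)⁻¹) ^ Fintype.card n :=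
        (Real.rpow_inv_natCast_pow hprod Fintype.card_ne_zero).symm
    _ ≤ ((∑ i, hA.1.eigenvalues i) / Fintype.card n) ^ Fintype.card n := by gcongr

lemma det_mul_det_le_trace_div_card_pow {A B : Matrix n n ℝ} (hA : A.PosSemidef)
    (hB : B.PosSemidef) :
    A.det * B.det ≤ ((A * B).trace / Fintype.card n) ^ Fintype.card n := by
  obtain ⟨C, rfl⟩ := exists_eq_transpose_mul_self hA
  have hdet := det_le_trace_div_card_pow (hB.mul_mul_conjTranspose_same C)
  rw [conjTranspose_eq_transpose_of_trivial, trace_mul_cycle] at hdet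
  calc (Cᵀ * C).det * B.det = (C * B * Cᵀ).det := by simp only [det_mul]; ring
    _ ≤ ((Cᵀ * C * B).trace / Fintype.card n) ^ Fintype.card n := hdet

lemma det_add_vecMulVec {R : Type*} [CommRing R] {A : Matrix n n R} (hA : IsUnit A.det)
    (u v : n → R) : (A + vecMulVec u v).det = A.det * (1 + v ⬝ᵥ A⁻¹ *ᵥ u) := by
  rw [vecMulVec_eq Unit, det_add_replicateCol_mul_replicateRow hA, det_unique (n := Unit),
    Matrix.add_apply, one_apply_eq, Matrix.mul_assoc, ← replicateCol_mulVec,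
    replicateRow_mul_replicateCol_apply]

end Matrix

section Frobenius

open Matrix

attribute [local instance] Matrix.frobeniusNormedAddCommGroup

variable {m n : Type*} [Fintype m] [Fintype n]

lemma frobenius_norm_sq_eq_trace (A : Matrix m n ℝ) : ‖A‖ ^ 2 = (Aᵀ * A).trace := by
  rw [frobenius_norm_def, ← Real.rpow_natCast, ← Real.rpow_mul (by positivity), trace,
    Finset.sum_comm]
  simp [mul_apply, sq]

lemma frobenius_norm_sub_one_sq [DecidableEq n] {A : Matrix n n ℝ} (hA : A.IsHermitian) :
    ‖A - 1‖ ^ 2 = (A ^ 2).trace - 2 * A.trace + Fintype.card n := by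
  have hsymm : Aᵀ = A := (conjTranspose_eq_transpose_of_trivial A).symm.trans hA
  rw [frobenius_norm_sq_eq_trace, transpose_sub, transpose_one, hsymm,
    show (A - 1) * (A - 1) = A ^ 2 - (2 : ℝ) • A + 1 by rw [two_smul]; noncomm_ring,
    trace_add, trace_sub, trace_smul, trace_one, smul_eq_mul]

end Frobenius

variable {M N : ℕ} {Φ : Fin M → E N}

section FrameMatrix

/-- The weighted frame operator `∑ i, c i • φ i (φ i)ᵀ`; for `c ≥ 0` these matrices are the points
of the cone in `coneDist`. -/
def frameMatrix (Φ : Fin M → E N) (c : Fin M → ℝ) : Matrix (Fin N) (Fin N) ℝ :=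
  ∑ i, c i • Matrix.vecMulVec (Φ i).ofLp (Φ i).ofLp

lemma frameMatrix_smul (Φ : Fin M → E N) (a : ℝ) (c : Fin M → ℝ) :
    frameMatrix Φ (a • c) = a • frameMatrix Φ c := by
  simp only [frameMatrix, Pi.smul_apply, smul_assoc, Finset.smul_sum]

lemma frameMatrix_add_single (Φ : Fin M → E N) (c : Fin M → ℝ) (i : Fin M) (s : ℝ) :
    frameMatrix Φ (c + Pi.single i s)
      = frameMatrix Φ c + s • Matrix.vecMulVec (Φ i).ofLp (Φ i).ofLp := by
  simp [frameMatrix, add_smul, Finset.sum_add_distrib, Pi.single_apply, ite_smul]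

lemma posSemidef_frameMatrix (Φ : Fin M → E N) {c : Fin M → ℝ} (hc : ∀ i, 0 ≤ c i) :
    (frameMatrix Φ c).PosSemidef :=
  Matrix.posSemidef_sum _ fun i _ =>
    (Matrix.posSemidef_vecMulVec_self_star (Φ i).ofLp).smul (hc i)

lemma continuous_frameMatrix (Φ : Fin M → E N) : Continuous (frameMatrix Φ) := by
  unfold frameMatrix
  fun_prop

lemma dotProduct_self_eq_norm_sq (v : E N) : v.ofLp ⬝ᵥ v.ofLp = ‖v‖ ^ 2 := by
  rw [← real_inner_self_eq_norm_sq, EuclideanSpace.inner_eq_star_dotProduct, star_trivial]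

lemma trace_mul_frameMatrix (X : Matrix (Fin N) (Fin N) ℝ) (Φ : Fin M → E N) (c : Fin M → ℝ) :
    (X * frameMatrix Φ c).trace = ∑ i, c i * (X *ᵥ (Φ i).ofLp ⬝ᵥ (Φ i).ofLp) := by
  simp [frameMatrix, Finset.mul_sum, Matrix.trace_sum, Matrix.mul_vecMulVec,
    Matrix.trace_vecMulVec]

lemma trace_frameMatrix (hΦ : ∀ i, ‖Φ i‖ = 1) (c : Fin M → ℝ) :
    (frameMatrix Φ c).trace = ∑ i, c i := by
  simpa [dotProduct_self_eq_norm_sq, hΦ] using trace_mul_frameMatrix 1 Φ c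

lemma dotProduct_frameMatrix_mulVec (Φ : Fin M → E N) (c : Fin M → ℝ) (v : E N) :
    v.ofLp ⬝ᵥ frameMatrix Φ c *ᵥ v.ofLp = ∑ i, c i * inner ℝ v (Φ i) ^ 2 := by
  simp [frameMatrix, Matrix.sum_mulVec, dotProduct_sum, Matrix.smul_mulVec,
    Matrix.vecMulVec_mulVec, EuclideanSpace.inner_eq_star_dotProduct, sq, dotProduct_comm]

lemma IsFrame.posDef_frameMatrix_one (hΦ : IsFrame Φ) : (frameMatrix Φ 1).PosDef := by
  obtain ⟨A, B, hA, -, hbounds⟩ := hΦ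
  refine .of_dotProduct_mulVec_pos (posSemidef_frameMatrix Φ fun _ => zero_le_one).1 fun x hx => ?_
  have hx' : WithLp.toLp 2 x ≠ 0 := by simpa using hx
  calc 0 < A * ‖WithLp.toLp 2 x‖ ^ 2 := by positivity
    _ ≤ ∑ i, |inner ℝ (WithLp.toLp 2 x) (Φ i)| ^ 2 := (hbounds _).1
    _ = ∑ i, (1 : Fin M → ℝ) i * inner ℝ (WithLp.toLp 2 x) (Φ i) ^ 2 := by
      simp only [sq_abs, Pi.one_apply, one_mul]
    _ = star x ⬝ᵥ frameMatrix Φ 1 *ᵥ x := (dotProduct_frameMatrix_mulVec Φ 1 _).symm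

lemma IsFrame.neZero [NeZero N] (hΦ : IsFrame Φ) : NeZero M := by
  refine ⟨fun hM => hΦ.posDef_frameMatrix_one.det_pos.ne' ?_⟩
  subst hM
  simp [frameMatrix]

end FrameMatrix

section DOptimal

/-- Weights of total mass `N` that maximize the determinant of the frame matrix (a D-optimal
design, with `c / N` as its probability vector). -/
structure IsDOptimal (Φ : Fin M → E N) (c : Fin M → ℝ) : Prop where
  nonneg : ∀ i, 0 ≤ c i
  sum_eq : ∑ i, c i = N
  det_le : ∀ d : Fin M → ℝ, (∀ i, 0 ≤ d i) → ∑ i, d i = N →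
    (frameMatrix Φ d).det ≤ (frameMatrix Φ c).det

lemma exists_isDOptimal [NeZero M] (Φ : Fin M → E N) : ∃ c, IsDOptimal Φ c := by
  have hclosed : IsClosed {d : Fin M → ℝ | ∑ i, d i = N} :=
    isClosed_eq (by fun_prop) continuous_const
  have hnonempty : (Set.Icc 0 (fun _ => (N : ℝ)) ∩ {d : Fin M → ℝ | ∑ i, d i = N}).Nonempty := by
    refine ⟨Pi.single 0 N, ⟨Pi.single_nonneg.mpr N.cast_nonneg, fun i => ?_⟩, by simp⟩
    by_cases hi : i = 0 <;> simp [hi]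
  obtain ⟨c, ⟨⟨hc, -⟩, hsum⟩, hmax⟩ := (isCompact_Icc.inter_right hclosed).exists_isMaxOn
    hnonempty (continuous_frameMatrix Φ).matrix_det.continuousOn
  exact ⟨c, hc, hsum, fun d hd hdsum =>
    hmax ⟨⟨hd, fun i => hdsum ▸ Finset.single_le_sum (fun j _ => hd j) (Finset.mem_univ i)⟩, hdsum⟩⟩

namespace IsDOptimal

variable {c : Fin M → ℝ}

lemma det_frameMatrix_le [NeZero N] (hc : IsDOptimal Φ c) {d : Fin M → ℝ} (hd : ∀ i, 0 ≤ d i) :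
    (frameMatrix Φ d).det ≤ ((∑ i, d i) / N) ^ N * (frameMatrix Φ c).det := by
  have hN : (N : ℝ) ≠ 0 := NeZero.ne _
  have hsum_nonneg : 0 ≤ ∑ i, d i := Finset.sum_nonneg fun i _ => hd i
  rcases hsum_nonneg.eq_or_lt with hzero | hpos
  · have hd0 : d = 0 := funext fun i =>
      (Finset.sum_eq_zero_iff_of_nonneg fun i _ => hd i).mp hzero.symm i (Finset.mem_univ i)
    simp [hd0, frameMatrix, NeZero.ne N]
  set a := (∑ i, d i) / N with ha
  have : 0 < a := by positivity
  have hsum : ∑ i, (a⁻¹ • d) i = N := by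
    simp only [Pi.smul_apply, smul_eq_mul, ← Finset.mul_sum, ha]
    field_simp
  have hscaled := hc.det_le (a⁻¹ • d) (fun i => mul_nonneg (by positivity) (hd i)) hsum
  rwa [frameMatrix_smul, Matrix.det_smul, Fintype.card_fin, inv_pow,
    inv_mul_le_iff₀ (by positivity)] at hscaled

lemma det_pos [NeZero N] (hc : IsDOptimal Φ c) (hΦ : IsFrame Φ) : 0 < (frameMatrix Φ c).det := by
  have hdet := hΦ.posDef_frameMatrix_one.det_pos.trans_le
    (hc.det_frameMatrix_le fun _ => zero_le_one)
  have hmass : (0 : ℝ) ≤ ∑ i, (1 : Fin M → ℝ) i := Finset.sum_nonneg fun _ _ => zero_le_one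
  exact pos_of_mul_pos_right hdet (by positivity)

lemma posDef [NeZero N] (hc : IsDOptimal Φ c) (hΦ : IsFrame Φ) : (frameMatrix Φ c).PosDef :=
  (posSemidef_frameMatrix Φ hc.nonneg).posDef_iff_det_ne_zero.mpr (hc.det_pos hΦ).ne'

end IsDOptimal

lemma le_of_hasDerivAt_of_add_mul_le {f : ℝ → ℝ} {f' x q : ℝ} (hf : HasDerivAt f f' x)
    (hq : ∀ s > 0, f x + s * q ≤ f (x + s)) : q ≤ f' := by
  refine ge_of_tendsto hf.tendsto_slope_zero_right ?_
  filter_upwards [self_mem_nhdsWithin] with s hs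
  rw [smul_eq_mul, le_inv_mul_iff₀ hs, le_sub_iff_add_le']
  exact hq s hs

-- The Kiefer–Wolfowitz equivalence theorem: the first-order optimality condition at `c` for
-- increasing the weight of `Φ i`.
theorem IsDOptimal.inv_mulVec_dotProduct_le_one [NeZero N] {c : Fin M → ℝ} (hc : IsDOptimal Φ c)
    (hΦ : IsFrame Φ) (i : Fin M) :
    (frameMatrix Φ c)⁻¹ *ᵥ (Φ i).ofLp ⬝ᵥ (Φ i).ofLp ≤ 1 := by
  have hN : (N : ℝ) ≠ 0 := NeZero.ne _
  have hderiv : HasDerivAt (fun s : ℝ => ((N + s) / N) ^ N) 1 0 :=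
    (((hasDerivAt_id 0).const_add (N : ℝ)).div_const (N : ℝ) |>.fun_pow N).congr_deriv
      (by simp [hN])
  refine le_of_hasDerivAt_of_add_mul_le hderiv fun s hs => ?_
  have hnonneg : ∀ j, 0 ≤ (c + Pi.single i s : Fin M → ℝ) j :=
    have hsingle : (0 : Fin M → ℝ) ≤ Pi.single i s := Pi.single_nonneg.mpr hs.le
    fun j => add_nonneg (hc.nonneg j) (hsingle j)
  have hsum : ∑ j, (c + Pi.single i s : Fin M → ℝ) j = N + s := by
    simp [Finset.sum_add_distrib, hc.sum_eq]
  have hdet := hc.det_frameMatrix_le hnonneg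
  rw [hsum, frameMatrix_add_single, ← Matrix.smul_vecMulVec,
    det_add_vecMulVec (hc.det_pos hΦ).ne'.isUnit, mul_comm _ (frameMatrix Φ c).det,
    mul_le_mul_iff_right₀ (hc.det_pos hΦ), Matrix.mulVec_smul, dotProduct_smul, smul_eq_mul,
    dotProduct_comm] at hdet
  simpa [hN] using hdet

end DOptimal

section Ellipsoid

lemma ellipsoid_transpose_mul_self (B : Matrix (Fin N) (Fin N) ℝ) (b : E N) :
    ellipsoid (Bᵀ * B) b
      = (fun v => v + -b) ⁻¹' (Matrix.toEuclideanLin B ⁻¹' Metric.closedBall 0 1) := by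
  ext v
  have quadratic_form_eq : (Bᵀ * B) *ᵥ (v - b).ofLp ⬝ᵥ (v - b).ofLp
      = ‖Matrix.toEuclideanLin B (v - b)‖ ^ 2 := by
    rw [← dotProduct_self_eq_norm_sq, ← Matrix.mulVec_mulVec, Matrix.mulVec_transpose,
      ← Matrix.dotProduct_mulVec, Matrix.ofLp_toLpLin, Matrix.toLin'_apply]
  rw [ellipsoid, Set.mem_ofPred_eq, quadratic_form_eq, Set.mem_preimage, Set.mem_preimage,
    mem_closedBall_zero_iff, ← sub_eq_add_neg, sq_le_one_iff₀ (norm_nonneg _)]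

lemma convex_ellipsoid {X : Matrix (Fin N) (Fin N) ℝ} (hX : X.PosSemidef) (b : E N) :
    Convex ℝ (ellipsoid X b) := by
  obtain ⟨B, rfl⟩ := exists_eq_transpose_mul_self hX
  rw [ellipsoid_transpose_mul_self]
  exact ((convex_closedBall 0 1).linear_preimage _).translate_preimage_left (-b)

lemma volume_ellipsoid {X : Matrix (Fin N) (Fin N) ℝ} (hX : X.PosDef) (b : E N) :
    volume (ellipsoid X b)
      = ENNReal.ofReal (√X.det)⁻¹ * volume (Metric.closedBall (0 : E N) 1) := by
  have hdet := hX.det_pos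
  obtain ⟨B, rfl⟩ := exists_eq_transpose_mul_self hX.posSemidef
  have det_toEuclideanLin : LinearMap.det (Matrix.toEuclideanLin B) = B.det :=
    LinearMap.det_toLpLin 2 B
  rw [Matrix.det_mul, Matrix.det_transpose] at hdet ⊢
  have hB : B.det ≠ 0 := left_ne_zero_of_mul hdet.ne'
  rw [ellipsoid_transpose_mul_self, measure_preimage_add_right,
    Measure.addHaar_preimage_linearMap _ (by rwa [det_toEuclideanLin]), det_toEuclideanLin,
    Real.sqrt_mul_self_eq_abs, abs_inv]

lemma convexHull_symmetrization_subset_ellipsoid {X : Matrix (Fin N) (Fin N) ℝ}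
    (hX : X.PosSemidef) (hΦ : ∀ i, X *ᵥ (Φ i).ofLp ⬝ᵥ (Φ i).ofLp ≤ 1) :
    convexHull ℝ (symmetrization Φ) ⊆ ellipsoid X 0 := by
  refine convexHull_min ?_ (convex_ellipsoid hX 0)
  rintro _ (⟨i, rfl⟩ | ⟨i, rfl⟩) <;> simpa [ellipsoid, Matrix.mulVec_neg] using hΦ i

lemma mulVec_dotProduct_le_one_of_subset_ellipsoid {X : Matrix (Fin N) (Fin N) ℝ}
    (hX : X.PosSemidef) {b : E N} (hsub : symmetrization Φ ⊆ ellipsoid X b) (i : Fin M) :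
    X *ᵥ (Φ i).ofLp ⬝ᵥ (Φ i).ofLp ≤ 1 := by
  have hplus : Φ i ∈ ellipsoid X b := hsub (Or.inl ⟨i, rfl⟩)
  have hminus : -Φ i ∈ ellipsoid X b := hsub (Or.inr ⟨i, rfl⟩)
  have hcentre : 0 ≤ X *ᵥ b.ofLp ⬝ᵥ b.ofLp := by
    rw [dotProduct_comm]
    exact hX.dotProduct_mulVec_nonneg b.ofLp
  simp only [ellipsoid, Set.mem_ofPred_eq, WithLp.ofLp_sub, WithLp.ofLp_neg, Matrix.mulVec_sub,
    Matrix.mulVec_neg, sub_dotProduct, dotProduct_sub, neg_dotProduct, dotProduct_neg]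
    at hplus hminus
  linarith

lemma det_mul_det_frameMatrix_le_one {X : Matrix (Fin N) (Fin N) ℝ} (hX : X.PosSemidef)
    {b : E N} (hsub : symmetrization Φ ⊆ ellipsoid X b) {c : Fin M → ℝ} (hc : ∀ i, 0 ≤ c i)
    (hsum : ∑ i, c i = N) : X.det * (frameMatrix Φ c).det ≤ 1 := by
  have hS := posSemidef_frameMatrix Φ hc
  have htrace_nonneg := trace_mul_nonneg hX hS
  have htrace_le : (X * frameMatrix Φ c).trace ≤ N := by
    rw [trace_mul_frameMatrix, ← hsum]
    exact Finset.sum_le_sum fun i _ => mul_le_of_le_one_right (hc i)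
      (mulVec_dotProduct_le_one_of_subset_ellipsoid hX hsub i)
  have hdet := det_mul_det_le_trace_div_card_pow hX hS
  rw [Fintype.card_fin] at hdet
  exact hdet.trans (pow_le_one₀ (by positivity) (div_le_one_of_le₀ htrace_le N.cast_nonneg))

lemma IsMinimalEllipsoid.normalizedVolume_eq {X : Matrix (Fin N) (Fin N) ℝ} {b : E N}
    (hmin : IsMinimalEllipsoid (convexHull ℝ (symmetrization Φ)) (ellipsoid X b))
    (hX : X.PosDef) : normalizedVolume Φ = (√X.det)⁻¹ := by
  have heps : IsMinimalEllipsoid (convexHull ℝ (symmetrization Φ)) (minimalEllipsoid Φ) :=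
    Classical.epsilon_spec ⟨_, hmin⟩
  have hvolume : volume (minimalEllipsoid Φ) = volume (ellipsoid X b) :=
    le_antisymm (heps.2.2 _ hmin.1 hmin.2.1) (hmin.2.2 _ heps.1 heps.2.1)
  have hball : (volume (Metric.closedBall (0 : E N) 1)).toReal ≠ 0 :=
    (ENNReal.toReal_pos (Metric.measure_closedBall_pos _ _ one_pos).ne'
      measure_closedBall_lt_top.ne).ne'
  rw [normalizedVolume, hvolume, volume_ellipsoid hX, ENNReal.toReal_mul,
    ENNReal.toReal_ofReal (by positivity), mul_div_cancel_right₀ _ hball]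

namespace IsDOptimal

variable [NeZero N] {c : Fin M → ℝ}

theorem isMinimalEllipsoid (hc : IsDOptimal Φ c) (hΦ : IsFrame Φ) :
    IsMinimalEllipsoid (convexHull ℝ (symmetrization Φ)) (ellipsoid (frameMatrix Φ c)⁻¹ 0) := by
  have hinv := (hc.posDef hΦ).inv
  refine ⟨⟨_, _, hinv, rfl⟩, convexHull_symmetrization_subset_ellipsoid hinv.posSemidef
    (hc.inv_mulVec_dotProduct_le_one hΦ), ?_⟩
  rintro _ ⟨X, b, hX, rfl⟩ hsub
  have hdet : X.det ≤ (frameMatrix Φ c)⁻¹.det := by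
    rw [Matrix.det_nonsing_inv, Ring.inverse_eq_inv', ← one_div, le_div_iff₀ (hc.det_pos hΦ)]
    exact det_mul_det_frameMatrix_le_one hX.posSemidef ((subset_convexHull ℝ _).trans hsub)
      hc.nonneg hc.sum_eq
  rw [volume_ellipsoid hinv, volume_ellipsoid hX]
  gcongr
  exact Real.sqrt_pos.mpr hX.det_pos

lemma normalizedVolume_eq (hc : IsDOptimal Φ c) (hΦ : IsFrame Φ) :
    normalizedVolume Φ = √(frameMatrix Φ c).det := by
  rw [(hc.isMinimalEllipsoid hΦ).normalizedVolume_eq (hc.posDef hΦ).inv, Matrix.det_nonsing_inv,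
    Ring.inverse_eq_inv', Real.sqrt_inv, inv_inv]

lemma normalizedVolume_rpow_eq (hc : IsDOptimal Φ c) (hΦ : IsFrame Φ) :
    normalizedVolume Φ ^ (4 / N : ℝ) = (frameMatrix Φ c).det ^ (2 / N : ℝ) := by
  rw [hc.normalizedVolume_eq hΦ, Real.sqrt_eq_rpow, ← Real.rpow_mul (hc.det_pos hΦ).le]
  congr 1
  ring

end IsDOptimal

lemma normalizedVolume_pos [NeZero N] (hΦ : IsFrame Φ) : 0 < normalizedVolume Φ := by
  have := hΦ.neZero
  obtain ⟨c, hc⟩ := exists_isDOptimal Φ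
  rw [hc.normalizedVolume_eq hΦ]
  exact Real.sqrt_pos.mpr (hc.det_pos hΦ)

end Ellipsoid

section ConeDist

attribute [local instance] Matrix.frobeniusNormedAddCommGroup

lemma coneDist_nonneg (Φ : Fin M → E N) : 0 ≤ coneDist Φ :=
  Real.iInf_nonneg fun _ => norm_nonneg _

lemma norm_frameMatrix_sub_one_sq (Φ : Fin M → E N) {c : Fin M → ℝ} (hc : ∀ i, 0 ≤ c i) :
    ‖frameMatrix Φ c - 1‖ ^ 2
      = (frameMatrix Φ c ^ 2).trace - 2 * (frameMatrix Φ c).trace + N := by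
  rw [frobenius_norm_sub_one_sq (posSemidef_frameMatrix Φ hc).1, Fintype.card_fin]

lemma coneDist_sq_le (Φ : Fin M → E N) {c : Fin M → ℝ} (hc : ∀ i, 0 ≤ c i) :
    coneDist Φ ^ 2 ≤ (frameMatrix Φ c ^ 2).trace - 2 * (frameMatrix Φ c).trace + N := by
  have hle : coneDist Φ ≤ ‖frameMatrix Φ c - 1‖ :=
    ciInf_le (f := fun c : {c : Fin M → ℝ // ∀ i, 0 ≤ c i} => ‖frameMatrix Φ c.1 - 1‖)
      ⟨0, Set.forall_mem_range.mpr fun _ => norm_nonneg _⟩ ⟨c, hc⟩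
  rw [← norm_frameMatrix_sub_one_sq Φ hc]
  exact pow_le_pow_left₀ (coneDist_nonneg Φ) hle 2

lemma le_coneDist_sq (Φ : Fin M → E N) {r : ℝ}
    (hr : ∀ c : Fin M → ℝ, (∀ i, 0 ≤ c i) →
      r ≤ (frameMatrix Φ c ^ 2).trace - 2 * (frameMatrix Φ c).trace + N) :
    r ≤ coneDist Φ ^ 2 := by
  have : Nonempty {c : Fin M → ℝ // ∀ i, 0 ≤ c i} := ⟨0, fun _ => le_rfl⟩
  refine (Real.sqrt_le_left (coneDist_nonneg Φ)).mp (le_ciInf fun c => ?_)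
  refine (Real.sqrt_le_left (norm_nonneg _)).mpr ((hr c c.2).trans_eq ?_)
  exact (norm_frameMatrix_sub_one_sq Φ c.2).symm

lemma coneDist_sq_le_dim (Φ : Fin M → E N) : coneDist Φ ^ 2 ≤ N := by
  simpa [frameMatrix] using coneDist_sq_le Φ (c := 0) fun _ => le_rfl

-- The distance from the identity to the cone is at most its distance to the ray through
-- `frameMatrix Φ c`.
theorem trace_frameMatrix_sq_le (Φ : Fin M → E N) {c : Fin M → ℝ} (hc : ∀ i, 0 ≤ c i) :
    (frameMatrix Φ c).trace ^ 2 ≤ (N - coneDist Φ ^ 2) * (frameMatrix Φ c ^ 2).trace := by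
  have hdist : ∀ t : ℝ, 0 ≤ t → coneDist Φ ^ 2
      ≤ t ^ 2 * (frameMatrix Φ c ^ 2).trace - 2 * (t * (frameMatrix Φ c).trace) + N := by
    intro t ht
    have hle := coneDist_sq_le Φ (c := t • c) fun i => mul_nonneg ht (hc i)
    rwa [frameMatrix_smul, smul_pow, Matrix.trace_smul, Matrix.trace_smul, smul_eq_mul,
      smul_eq_mul] at hle
  have htrace : 0 ≤ (frameMatrix Φ c).trace := (posSemidef_frameMatrix Φ hc).trace_nonneg
  have htrace_sq : 0 ≤ (frameMatrix Φ c ^ 2).trace := by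
    rw [sq]
    exact trace_mul_nonneg (posSemidef_frameMatrix Φ hc) (posSemidef_frameMatrix Φ hc)
  have hdiscrim := discrim_le_zero (a := (frameMatrix Φ c ^ 2).trace)
    (b := -2 * (frameMatrix Φ c).trace) (c := N - coneDist Φ ^ 2) fun t => by
      rcases le_total 0 t with ht | ht
      · linarith [hdist t ht]
      · have := mul_nonneg_of_nonpos_of_nonpos ht (neg_nonpos.mpr htrace)
        have := mul_nonneg htrace_sq (mul_self_nonneg t)
        linarith [coneDist_sq_le_dim Φ]
  rw [discrim] at hdiscrim
  linarith

lemma coneDist_sq_le_sub_one (hΦ : ∀ i, ‖Φ i‖ = 1) (i : Fin M) : coneDist Φ ^ 2 ≤ N - 1 := by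
  have hnonneg : (0 : Fin M → ℝ) ≤ Pi.single i 1 := Pi.single_nonneg.mpr zero_le_one
  have hray := trace_frameMatrix_sq_le Φ hnonneg
  have hsingle : frameMatrix Φ (Pi.single i 1) = Matrix.vecMulVec (Φ i).ofLp (Φ i).ofLp := by
    simp [frameMatrix, Pi.single_apply, ite_smul]
  rw [hsingle, sq (Matrix.vecMulVec _ _), Matrix.vecMulVec_mul_vecMulVec, Matrix.trace_vecMulVec,
    Matrix.trace_vecMulVec, dotProduct_smul, dotProduct_self_eq_norm_sq, hΦ] at hray
  norm_num at hray
  linarith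

end ConeDist

section Bounds

namespace IsDOptimal

variable [NeZero N] {c : Fin M → ℝ}

lemma det_rpow_le_one (hc : IsDOptimal Φ c) (hΦ : ∀ i, ‖Φ i‖ = 1) :
    (frameMatrix Φ c).det ^ (2 / N : ℝ) ≤ 1 := by
  have hpsd := posSemidef_frameMatrix Φ hc.nonneg
  have hdet := det_le_trace_div_card_pow hpsd
  rw [Fintype.card_fin, trace_frameMatrix hΦ, hc.sum_eq, div_self (NeZero.ne _), one_pow] at hdet
  exact Real.rpow_le_one hpsd.det_nonneg hdet (by positivity)

lemma det_frameMatrix_rpow_le (hc : IsDOptimal Φ c) {d : Fin M → ℝ} (hd : ∀ i, 0 ≤ d i) :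
    (frameMatrix Φ d).det ^ (2 / N : ℝ)
      ≤ ((∑ i, d i) / N) ^ 2 * (frameMatrix Φ c).det ^ (2 / N : ℝ) := by
  have hmass : 0 ≤ (∑ i, d i) / N := div_nonneg (Finset.sum_nonneg fun i _ => hd i) N.cast_nonneg
  rw [← pow_rpow_two_div (NeZero.ne N) hmass, ← Real.mul_rpow (by positivity)
    (posSemidef_frameMatrix Φ hc.nonneg).det_nonneg]
  exact Real.rpow_le_rpow (posSemidef_frameMatrix Φ hd).det_nonneg (hc.det_frameMatrix_le hd)
    (by positivity)

lemma sub_det_rpow_mul_trace_sq_le (hc : IsDOptimal Φ c) (hΦ : ∀ i, ‖Φ i‖ = 1)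
    {d : Fin M → ℝ} (hd : ∀ i, 0 ≤ d i) :
    (N - (frameMatrix Φ c).det ^ (2 / N : ℝ)) * (frameMatrix Φ d).trace ^ 2
      ≤ N * (N - 1) * (frameMatrix Φ d ^ 2).trace := by
  have hkober := trace_sq_le_of_posSemidef (posSemidef_frameMatrix Φ hd)
  have hdet := hc.det_frameMatrix_rpow_le hd
  rw [← trace_frameMatrix hΦ] at hdet
  rw [Fintype.card_fin] at hkober
  set p := (frameMatrix Φ d).trace
  set q := (frameMatrix Φ d ^ 2).trace
  set W := (frameMatrix Φ c).det ^ (2 / N : ℝ)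
  have hN : (0 : ℝ) < N := by exact_mod_cast NeZero.pos N
  calc (N - W) * p ^ 2 = N * (p ^ 2 - N * ((p / N) ^ 2 * W)) := by field_simp
    _ ≤ N * ((N - 1) * q) := by
      gcongr
      linarith [mul_le_mul_of_nonneg_left hdet hN.le]
    _ = N * (N - 1) * q := by ring

-- The square added in the computation vanishes at the minimizer `p = N * (N - 1) / (N - W)` of
-- `q - 2 * p + N` subject to `(N - W) * p ^ 2 ≤ N * (N - 1) * q`.
theorem mul_one_sub_det_rpow_le (hc : IsDOptimal Φ c) (hN : 2 ≤ N) (hΦ : ∀ i, ‖Φ i‖ = 1) :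
    N * (1 - (frameMatrix Φ c).det ^ (2 / N : ℝ))
      ≤ coneDist Φ ^ 2 * (N - (frameMatrix Φ c).det ^ (2 / N : ℝ)) := by
  have hdim : (2 : ℝ) ≤ N := by exact_mod_cast hN
  have hW := hc.det_rpow_le_one hΦ
  have hkober := fun {d : Fin M → ℝ} => hc.sub_det_rpow_mul_trace_sq_le hΦ (d := d)
  set W := (frameMatrix Φ c).det ^ (2 / N : ℝ)
  have hNW : 0 < N - W := by linarith
  rw [← div_le_iff₀ hNW]
  refine le_coneDist_sq Φ fun d hd => ?_
  rw [div_le_iff₀ hNW]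
  set p := (frameMatrix Φ d).trace
  set q := (frameMatrix Φ d ^ 2).trace
  have hscale : (0 : ℝ) < N * (N - 1) := mul_pos (by linarith) (by linarith)
  refine le_of_mul_le_mul_left ?_ hscale
  calc N * (N - 1) * (N * (1 - W))
      ≤ N * (N - 1) * (N * (1 - W)) + ((N - W) * p - N * (N - 1)) ^ 2 :=
        le_add_of_nonneg_right (sq_nonneg _)
    _ = ((N - W) * p ^ 2 + N * (N - 1) * (N - 2 * p)) * (N - W) := by ring
    _ ≤ (N * (N - 1) * q + N * (N - 1) * (N - 2 * p)) * (N - W) :=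
        mul_le_mul_of_nonneg_right (by linarith [hkober hd]) hNW.le
    _ = N * (N - 1) * ((q - 2 * p + N) * (N - W)) := by ring

theorem det_rpow_mul_le (hc : IsDOptimal Φ c) (hΦ : ∀ i, ‖Φ i‖ = 1) :
    (frameMatrix Φ c).det ^ (2 / N : ℝ) * ((N - 1) * (N - coneDist Φ ^ 2))
      ≤ N * (N - 1 - coneDist Φ ^ 2) := by
  have hN : (0 : ℝ) < N := by exact_mod_cast NeZero.pos N
  have hmaclaurin := card_mul_det_rpow_le_of_posSemidef (posSemidef_frameMatrix Φ hc.nonneg)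
  have hray := trace_frameMatrix_sq_le Φ hc.nonneg
  rw [Fintype.card_fin] at hmaclaurin
  rw [trace_frameMatrix hΦ, hc.sum_eq] at hmaclaurin hray
  have hscaled := mul_le_mul_of_nonneg_right hmaclaurin (sub_nonneg.mpr (coneDist_sq_le_dim Φ))
  refine le_of_mul_le_mul_left ?_ hN
  linear_combination hscaled + hray

end IsDOptimal

namespace IsUnitNormFrame

lemma coneDist_sq_le_sub_one [NeZero N] (hΦ : IsUnitNormFrame Φ) : coneDist Φ ^ 2 ≤ N - 1 :=
  have := hΦ.1.neZero
  UnitFrame.coneDist_sq_le_sub_one hΦ.2 0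

theorem le_normalizedVolume_rpow (hΦ : IsUnitNormFrame Φ) (hN : 2 ≤ N) :
    N * (1 - coneDist Φ ^ 2) / (N - coneDist Φ ^ 2) ≤ normalizedVolume Φ ^ (4 / N : ℝ) := by
  have : NeZero N := ⟨by omega⟩
  have := hΦ.1.neZero
  obtain ⟨c, hc⟩ := exists_isDOptimal Φ
  rw [hc.normalizedVolume_rpow_eq hΦ.1, div_le_iff₀ (by linarith [hΦ.coneDist_sq_le_sub_one])]
  linarith [hc.mul_one_sub_det_rpow_le hN hΦ.2]

theorem normalizedVolume_rpow_le (hΦ : IsUnitNormFrame Φ) (hN : 2 ≤ N) :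
    normalizedVolume Φ ^ (4 / N : ℝ)
      ≤ N * (N - 1 - coneDist Φ ^ 2) / ((N - 1) * (N - coneDist Φ ^ 2)) := by
  have : NeZero N := ⟨by omega⟩
  have := hΦ.1.neZero
  have hdim : (2 : ℝ) ≤ N := by exact_mod_cast hN
  obtain ⟨c, hc⟩ := exists_isDOptimal Φ
  have hdist := hΦ.coneDist_sq_le_sub_one
  rw [hc.normalizedVolume_rpow_eq hΦ.1, le_div_iff₀ (mul_pos (by linarith) (by linarith))]
  exact hc.det_rpow_mul_le hΦ.2

lemma normalizedVolume_upper_bound_le_one (hΦ : IsUnitNormFrame Φ) (hN : 2 ≤ N) :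
    N * (N - 1 - coneDist Φ ^ 2) / ((N - 1) * (N - coneDist Φ ^ 2)) ≤ 1 := by
  have : NeZero N := ⟨by omega⟩
  have hdim : (2 : ℝ) ≤ N := by exact_mod_cast hN
  have hdist := hΦ.coneDist_sq_le_sub_one
  rw [div_le_one (mul_pos (by linarith) (by linarith))]
  linarith [sq_nonneg (coneDist Φ)]

lemma coneDist_sq_le_mul_one_sub_rpow (hΦ : IsUnitNormFrame Φ) (hN : 2 ≤ N) :
    coneDist Φ ^ 2 ≤ N * (N - 1) * (1 - normalizedVolume Φ ^ (4 / N : ℝ)) := by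
  have : NeZero N := ⟨by omega⟩
  have hdim : (2 : ℝ) ≤ N := by exact_mod_cast hN
  have hdist := hΦ.coneDist_sq_le_sub_one
  have hupper := hΦ.normalizedVolume_rpow_le hN
  have hW := hupper.trans (hΦ.normalizedVolume_upper_bound_le_one hN)
  rw [le_div_iff₀ (mul_pos (by linarith) (by linarith))] at hupper
  calc coneDist Φ ^ 2
      ≤ (N - coneDist Φ ^ 2) * (N - 1) * (1 - normalizedVolume Φ ^ (4 / N : ℝ)) := by
        linear_combination hupper
    _ ≤ N * (N - 1) * (1 - normalizedVolume Φ ^ (4 / N : ℝ)) := by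
        gcongr
        · linarith
        · linarith [sq_nonneg (coneDist Φ)]

end IsUnitNormFrame

end Bounds

section Convergence

variable {ι : Type*} {l : Filter ι} {m : ι → ℕ} {Ψ : (k : ι) → Fin (m k) → E N}

lemma tendsto_coneDist_of_tendsto_normalizedVolume (hN : 2 ≤ N) (hΨ : ∀ k, IsUnitNormFrame (Ψ k))
    (hV : Tendsto (fun k => normalizedVolume (Ψ k)) l (𝓝 1)) :
    Tendsto (fun k => coneDist (Ψ k)) l (𝓝 0) := by
  have hbound : Tendsto (fun k => N * (N - 1) * (1 - normalizedVolume (Ψ k) ^ (4 / N : ℝ))) l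
      (𝓝 0) := by
    simpa using ((hV.rpow_const (p := 4 / N) (Or.inl one_ne_zero)).const_sub 1).const_mul
      (N * (N - 1) : ℝ)
  have hsq : Tendsto (fun k => coneDist (Ψ k) ^ 2) l (𝓝 0) :=
    squeeze_zero (fun k => sq_nonneg _) (fun k => (hΨ k).coneDist_sq_le_mul_one_sub_rpow hN) hbound
  simpa [Real.sqrt_sq (coneDist_nonneg _)] using hsq.sqrt

lemma tendsto_normalizedVolume_of_tendsto_coneDist (hN : 2 ≤ N) (hΨ : ∀ k, IsUnitNormFrame (Ψ k))
    (hD : Tendsto (fun k => coneDist (Ψ k)) l (𝓝 0)) :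
    Tendsto (fun k => normalizedVolume (Ψ k)) l (𝓝 1) := by
  have : NeZero N := ⟨by omega⟩
  have hlower : Tendsto
      (fun k => N * (1 - coneDist (Ψ k) ^ 2) / (N - coneDist (Ψ k) ^ 2)) l (𝓝 1) := by
    have hsq : Tendsto (fun k => coneDist (Ψ k) ^ 2) l (𝓝 0) := by simpa using hD.pow 2
    have hquot := ((hsq.const_sub 1).const_mul (N : ℝ)).div (hsq.const_sub (N : ℝ))
      (by simp [NeZero.ne N])
    rwa [sub_zero, sub_zero, mul_one, div_self (NeZero.ne _)] at hquot
  have hrpow : Tendsto (fun k => normalizedVolume (Ψ k) ^ (4 / N : ℝ)) l (𝓝 1) :=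
    tendsto_of_tendsto_of_tendsto_of_le_of_le hlower tendsto_const_nhds
      (fun k => (hΨ k).le_normalizedVolume_rpow hN)
      (fun k => ((hΨ k).normalizedVolume_rpow_le hN).trans
        ((hΨ k).normalizedVolume_upper_bound_le_one hN))
  have hroot := hrpow.rpow_const (p := (4 / N : ℝ)⁻¹) (Or.inl one_ne_zero)
  rw [Real.one_rpow] at hroot
  exact hroot.congr fun k =>
    Real.rpow_rpow_inv (normalizedVolume_pos (hΨ k).1).le (by simp [NeZero.ne N])

end Convergence

end UnitFrame

theorem theorem3p2 (N : ℕ) (hN : 2 ≤ N) :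
    (∀ (M : ℕ) (Φ : Fin M → UnitFrame.E N), UnitFrame.IsUnitNormFrame Φ →
      (UnitFrame.coneDist Φ < 1 →
        (N : ℝ) * (1 - UnitFrame.coneDist Φ ^ 2) / ((N : ℝ) - UnitFrame.coneDist Φ ^ 2)
          ≤ UnitFrame.normalizedVolume Φ ^ ((4 : ℝ) / (N : ℝ))) ∧
      UnitFrame.normalizedVolume Φ ^ ((4 : ℝ) / (N : ℝ))
        ≤ (N : ℝ) * ((N : ℝ) - 1 - UnitFrame.coneDist Φ ^ 2)
          / (((N : ℝ) - 1) * ((N : ℝ) - UnitFrame.coneDist Φ ^ 2)) ∧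
      (N : ℝ) * ((N : ℝ) - 1 - UnitFrame.coneDist Φ ^ 2)
          / (((N : ℝ) - 1) * ((N : ℝ) - UnitFrame.coneDist Φ ^ 2)) ≤ 1) ∧
    (∀ (ι : Type*) (l : Filter ι) (M : ι → ℕ) (Φ : (k : ι) → Fin (M k) → UnitFrame.E N),
      (∀ k, UnitFrame.IsUnitNormFrame (Φ k)) →
      (Tendsto (fun k => UnitFrame.normalizedVolume (Φ k)) l (𝓝 1) ↔
        Tendsto (fun k => UnitFrame.coneDist (Φ k)) l (𝓝 0))) :=
  ⟨fun _ _ hΦ => ⟨fun _ => hΦ.le_normalizedVolume_rpow hN, hΦ.normalizedVolume_rpow_le hN,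
      hΦ.normalizedVolume_upper_bound_le_one hN⟩,
    fun _ _ _ _ hΦ => ⟨UnitFrame.tendsto_coneDist_of_tendsto_normalizedVolume hN hΦ,
      UnitFrame.tendsto_normalizedVolume_of_tendsto_coneDist hN hΦ⟩⟩
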